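/- Let $q$ be a power of an odd prime $p$, let $m\ge 1$ with $(q,m)\ne(3,1)$, put $n=q^m-1$, and let $\alpha$ be a generator of $\mathrm{GF}(q^m)^*$. Let $\mathrm{Tr}$ be the trace from $\mathrm{GF}(q^m)$ to $\mathrm{GF}(q)$, let $s_i=\mathrm{Tr}\big((\alpha^i+1)^2\big)$ for $i\ge 0$ (the sequence attached to $f(x)=x^2$), and let $S(x)=\sum_{i=0}^{n-1}s_ix^i\in\mathrm{GF}(q)[x]$. Let $\mathcal C_s$ be the code of length $n$ over $\mathrm{GF}(q)$ which, under the identification of $(c_0,\dots,c_{n-1})$ with $c_0+c_1x+\cdots+c_{n-1}x^{n-1}$, is the ideal of $\mathrm{GF}(q)[x]/(x^n-1)$ generated by $\dfrac{x^n-1}{\gcd(S(x),\,x^n-1)}$. Put $\mathbb N_p(m)=0$ if $p\mid m$ and $\mathbb N_p(m)=1$ otherwise, and let $m_a(x)$ be the minimal polynomial of $a$ over $\mathrm{GF}(q)$. Then $\mathcal C_s$ is an $[n,\;n-2m-\mathbb N_p(m),\;d]$ cyclic code (length, dimension, minimum distance) with generator polynomial $$(x-1)^{\mathbb N_p(m)}\,m_{\alpha^{-1}}(x)\,m_{\alpha^{-2}}(x),$$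 that is, this polynomial is the monic divisor of $x^n-1$ that generates the ideal $\mathcal C_s$, and $$\begin{cases} d=4 & \text{if } q=3 \text{ and } \mathbb N_p(m)=0,\\ 4\le d\le 5 & \text{if } q=3 \text{ and } \mathbb N_p(m)=1,\\ 3\le d\le 4 & \text{if } q>3 \text{ and } \mathbb N_p(m)=1,\\ d=3 & \text{if } q>3 \text{ and } \mathbb N_p(m)=0.\end{cases}$$ -/

import Mathlib

open Polynomial

noncomputable section

/-- `ℕ_p(i)`: it is `0` if `i ≡ 0 (mod p)` and `1` otherwise. -/
def NN (p i : ℕ) : ℕ := if p ∣ i then 0 else 1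

/-- The sequence `s_i = Tr (f (α ^ i + 1))`, `i ≥ 0`, over `K` attached to a function `f` on
the extension field `L` and to `α ∈ L`; here `Tr` is the trace from `L` to `K`. -/
def definingSeq (K : Type*) {L : Type*} [Field K] [Field L] [Algebra K L]
    (f : L → L) (α : L) (i : ℕ) : K :=
  Algebra.trace K L (f (α ^ i + 1))

/-- `S(x) = s_0 + s_1 x + ⋯ + s_{n-1} x^{n-1}`. -/
def seqPoly {K : Type*} [Field K] (s : ℕ → K) (n : ℕ) : K[X] :=
  ∑ i ∈ Finset.range n, C (s i) * X ^ i

open Classical in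
/-- `(x^n - 1) / gcd (S(x), x^n - 1)`, with the monic greatest common divisor. -/
def seqGenPoly {K : Type*} [Field K] (s : ℕ → K) (n : ℕ) : K[X] :=
  (X ^ n - 1) / normalize (EuclideanDomain.gcd (seqPoly s n) (X ^ n - 1))

/-- The map `(c_0, …, c_{n-1}) ↦ c_0 + c_1 x + ⋯ + c_{n-1} x^{n-1}` from `K^n` to
`K[x] / (x^n - 1)`. -/
def vecToQuot (K : Type*) [Field K] (n : ℕ) :
    (Fin n → K) →ₗ[K] K[X] ⧸ Ideal.span {(X ^ n - 1 : K[X])} where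
  toFun c := Ideal.Quotient.mk _ (∑ i : Fin n, C (c i) * X ^ (i : ℕ))
  map_add' c c' := by
    rw [← map_add, ← Finset.sum_add_distrib]
    simp only [Pi.add_apply, map_add, add_mul]
  map_smul' a c := by
    have h : (∑ i : Fin n, C ((a • c) i) * X ^ (i : ℕ) : K[X]) =
        a • ∑ i : Fin n, C (c i) * X ^ (i : ℕ) := by
      rw [Finset.smul_sum]
      refine Finset.sum_congr rfl fun i _ => ?_
      rw [smul_eq_C_mul, Pi.smul_apply, smul_eq_mul, C_mul, mul_assoc]
    rw [h]
    rfl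

/-- The linear code of length `n` over `K` that corresponds to the ideal `(g(x))` of
`K[x] / (x^n - 1)`. -/
def codeOfPoly {K : Type*} [Field K] (n : ℕ) (g : K[X]) : Submodule K (Fin n → K) :=
  ((Ideal.span {Ideal.Quotient.mk (Ideal.span {(X ^ n - 1 : K[X])}) g}).restrictScalars K).comap
    (vecToQuot K n)

/-- The code of length `n` defined by the sequence `s`. -/
def seqCode {K : Type*} [Field K] (s : ℕ → K) (n : ℕ) : Submodule K (Fin n → K) :=
  codeOfPoly n (seqGenPoly s n)

/-- A linear code is cyclic if `(c_0, …, c_{n-1}) ∈ 𝒞` implies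
`(c_{n-1}, c_0, …, c_{n-2}) ∈ 𝒞`. -/
def IsCyclicCode {K : Type*} [Field K] {n : ℕ} (𝒞 : Submodule K (Fin n → K)) : Prop :=
  ∀ c ∈ 𝒞, (fun i => c ((finRotate n).symm i)) ∈ 𝒞

/-- `g` is the generator polynomial of `𝒞`: the monic divisor of `x^n - 1` whose class generates
the ideal of `K[x] / (x^n - 1)` corresponding to `𝒞`. -/
def IsGeneratorPoly {K : Type*} [Field K] {n : ℕ} (𝒞 : Submodule K (Fin n → K))
    (g : K[X]) : Prop :=
  g.Monic ∧ g ∣ X ^ n - 1 ∧ 𝒞 = codeOfPoly n g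

open Classical in
/-- The minimum distance: the least Hamming distance between two distinct codewords (`0`, by the
convention `sInf ∅ = 0`, if there are no two distinct codewords). -/
def minDist {K : Type*} [Field K] {n : ℕ} (𝒞 : Submodule K (Fin n → K)) : ℕ :=
  sInf {d | ∃ c ∈ 𝒞, ∃ c' ∈ 𝒞, c ≠ c' ∧ hammingDist c c' = d}

end

/-! ### Cyclic codes given by a divisor of `X ^ n - 1` -/

/-! Write the trace as a sum over the Galois group `G` of `L / K`: `s_i` is the sum over `σ` of
`σ(α²)^i + 2 σ(α)^i + 1`. For nonzero `γ`, summing `s_i γ^i` gives geometric sums, each `-1` when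
its ratio is `1` and `0` otherwise. So `S(γ) ≠ 0` exactly when `γ` is conjugate to `α⁻¹` or `α⁻²`,
or `γ = 1` and `p ∤ m` (`aeval_seqPoly_ne_zero_iff`). Since `x^n - 1` is separable and splits over
`L`, these `γ` determine its cofactor by the gcd (`seqGenPoly_eq`). Both minimal polynomials have
degree `m`, which gives the dimension.

For the distance, index coordinates by the nonzero `y` in `L`: codewords satisfy `∑ c_y y = ∑ c_y y²
= 0`, and `∑ c_y = 0` if `p ∤ m`. A Vandermonde argument excludes weights 1 and 2. For `q = 3`
coefficients are `±1` and characteristic 3 excludes weight 3. Short words come from counting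
equations on points of `K` when `q > 3`, and from an explicit four-point configuration, translated
if `p ∤ m`, when `q = 3`. -/

theorem mem_codeOfPoly {K : Type*} [Field K] {n : ℕ} {g : K[X]} (hg : g ∣ X ^ n - 1)
    (c : Fin n → K) :
    c ∈ codeOfPoly n g ↔ g ∣ ∑ i : Fin n, C (c i) * X ^ (i : ℕ) := by
  change Ideal.Quotient.mk (Ideal.span {(X ^ n - 1 : K[X])})
    (∑ i : Fin n, C (c i) * X ^ (i : ℕ)) ∈
      Ideal.span {Ideal.Quotient.mk (Ideal.span {(X ^ n - 1 : K[X])}) g} ↔ _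
  rw [Ideal.mem_span_singleton]
  constructor
  · rintro ⟨r, hr⟩
    obtain ⟨r, rfl⟩ := Ideal.Quotient.mk_surjective r
    rw [← map_mul, Ideal.Quotient.eq, Ideal.mem_span_singleton] at hr
    exact (dvd_iff_dvd_of_dvd_sub (hg.trans hr)).2 (dvd_mul_right _ _)
  · exact fun h => map_dvd _ h

/-- The code is the kernel of the map from `K^n` to `K[x]/(g)`, which is surjective because
remainders modulo `g` have degree below `n`. -/
theorem finrank_codeOfPoly {K : Type*} [Field K] {n : ℕ} (hn : 0 < n) {g : K[X]} (hm : g.Monic)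
    (hg : g ∣ X ^ n - 1) : g.natDegree ≤ n ∧
    Module.finrank K (codeOfPoly n g) = n - g.natDegree := by
  have hdeg : g.natDegree ≤ n := by
    have h1 : (X ^ n - 1 : K[X]) = X ^ n - C 1 := by simp
    have := natDegree_le_of_dvd hg (h1 ▸ (monic_X_pow_sub_C (1 : K) hn.ne').ne_zero)
    rwa [h1, natDegree_X_pow_sub_C] at this
  refine ⟨hdeg, ?_⟩
  let φ : (Fin n → K) →ₗ[K] AdjoinRoot g :=
    { toFun := fun c => AdjoinRoot.mk g (∑ i : Fin n, C (c i) * X ^ (i : ℕ))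
      map_add' := fun c c' => by
        rw [← map_add, ← Finset.sum_add_distrib]
        simp only [Pi.add_apply, map_add, add_mul]
      map_smul' := fun a c => by
        rw [RingHom.id_apply, AdjoinRoot.smul_mk, Finset.smul_sum]
        simp [smul_eq_C_mul, mul_assoc] }
  have hker : φ.ker = codeOfPoly n g := by
    ext c
    rw [mem_codeOfPoly hg, LinearMap.mem_ker]
    exact AdjoinRoot.mk_eq_zero
  have hsurj : φ.range = ⊤ := by
    rw [LinearMap.range_eq_top]
    intro y
    obtain ⟨f, rfl⟩ := AdjoinRoot.mk_surjective y
    refine ⟨fun i => (f %ₘ g).coeff i, ?_⟩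
    have h1 : (∑ i : Fin n, C ((f %ₘ g).coeff i) * X ^ (i : ℕ)) = f %ₘ g := by
      rw [Fin.sum_univ_eq_sum_range (fun i => C ((f %ₘ g).coeff i) * X ^ i)]
      -- For `g = 1` the remainder is `0`, whose `natDegree` is not below that of `g`.
      by_cases h1 : g = 1
      · subst h1; simp
      · exact (as_sum_range_C_mul_X_pow' _
          ((natDegree_modByMonic_lt f hm h1).trans_le hdeg)).symm
    change AdjoinRoot.mk g _ = _
    rw [h1, AdjoinRoot.mk_eq_mk]
    rw [modByMonic_eq_sub_mul_div]
    simp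
  have := φ.finrank_range_add_finrank_ker
  rw [hker, hsurj, finrank_top, Module.finrank_fin_fun,
    (AdjoinRoot.powerBasis' hm).finrank, AdjoinRoot.powerBasis'_dim] at this
  omega

/-- Differences of codewords are codewords. A nonzero word must be supplied because the infimum of
the empty set is `0`. -/
theorem le_minDist {K : Type*} [Field K] [DecidableEq K] {n k : ℕ} {𝒞 : Submodule K (Fin n → K)}
    (hne : ∃ c ∈ 𝒞, c ≠ 0) (h : ∀ c ∈ 𝒞, c ≠ 0 → k ≤ hammingNorm c) : k ≤ minDist 𝒞 := by
  refine le_csInf ?_ ?_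
  · obtain ⟨c, hc, hc0⟩ := hne
    exact ⟨_, c, hc, 0, 𝒞.zero_mem, hc0, rfl⟩
  · rintro d ⟨c, hc, c', hc', hcc, rfl⟩
    have := h (c - c') (𝒞.sub_mem hc hc') (sub_ne_zero.2 hcc)
    have h2 : hammingNorm (c - c') = hammingDist c c' := by
      simp [hammingNorm, hammingDist, sub_ne_zero]
    rw [h2] at this
    refine this.trans (le_of_eq ?_)
    congr!

theorem minDist_le {K : Type*} [Field K] [DecidableEq K] {n : ℕ} {𝒞 : Submodule K (Fin n → K)}
    {c : Fin n → K} (hc : c ∈ 𝒞) (h0 : c ≠ 0) : minDist 𝒞 ≤ hammingNorm c := by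
  refine csInf_le (OrderBot.bddBelow _) ⟨c, hc, 0, 𝒞.zero_mem, h0, ?_⟩
  rw [← hammingDist_zero_right]
  congr!

/-! ### Divisors of `X ^ n - 1` and their roots -/

/-- A divisor of a polynomial with simple roots that splits over `L` divides every polynomial
vanishing at its roots. -/
theorem dvd_of_forall_root {K L : Type*} [Field K] [Field L] [Algebra K L] {t f h : K[X]}
    (ht : t.Separable) (hs : (t.map (algebraMap K L)).Splits) (hf : f ∣ t)
    (H : ∀ γ : L, aeval γ f = 0 → aeval γ h = 0) : f ∣ h := by
  rw [← map_dvd_map' (algebraMap K L)]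
  have hsp : (f.map (algebraMap K L)).Splits :=
    hs.of_dvd (Polynomial.map_ne_zero ht.ne_zero) (Polynomial.map_dvd (algebraMap K L) hf)
  have hsep : (f.map (algebraMap K L)).Separable := (ht.of_dvd hf).map
  by_cases h0 : h = 0
  · simp [h0]
  · rw [hsp.dvd_iff_roots_le_roots hsep.ne_zero (Polynomial.map_ne_zero h0),
      Multiset.le_iff_subset (nodup_roots hsep)]
    intro γ hγ
    rw [mem_roots (Polynomial.map_ne_zero h0), IsRoot, eval_map_algebraMap]
    rw [mem_roots hsep.ne_zero, IsRoot, eval_map_algebraMap] at hγ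
    exact H γ hγ

theorem isCoprime_minpoly {K L : Type*} [Field K] [Field L] [Algebra K L]
    [FiniteDimensional K L] {a b : L} (h : ¬ IsConjRoot K a b) :
    IsCoprime (minpoly K a) (minpoly K b) := by
  have ha := minpoly.irreducible (Algebra.IsIntegral.isIntegral (R := K) a)
  have hb := minpoly.irreducible (Algebra.IsIntegral.isIntegral (R := K) b)
  rw [ha.coprime_iff_not_dvd]
  intro hd
  exact h (eq_of_monic_of_associated (minpoly.monic (Algebra.IsIntegral.isIntegral a))
    (minpoly.monic (Algebra.IsIntegral.isIntegral b)) (ha.associated_of_dvd hb hd))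

theorem aeval_minpoly_eq_zero_iff {K L : Type*} [Field K] [Field L] [Algebra K L]
    [FiniteDimensional K L] [Normal K L] {a γ : L} :
    aeval γ (minpoly K a) = 0 ↔ ∃ σ : L ≃ₐ[K] L, σ a = γ := by
  constructor
  · intro h
    have hi := minpoly.irreducible (Algebra.IsIntegral.isIntegral (R := K) a)
    have : minpoly K a = minpoly K γ :=
      minpoly.eq_of_irreducible_of_monic hi h (minpoly.monic (Algebra.IsIntegral.isIntegral a))
    exact isConjRoot_iff_exists_algEquiv.1 (show IsConjRoot K γ a from this.symm)
  · rintro ⟨σ, rfl⟩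
    rw [← minpoly.algEquiv_eq σ a]
    exact minpoly.aeval _ _

theorem natDegree_minpoly_of_injective {K L : Type*} [Field K] [Field L] [Algebra K L]
    [FiniteDimensional K L] [IsGalois K L] {a : L}
    (h : ∀ σ τ : L ≃ₐ[K] L, σ a = τ a → σ = τ) :
    (minpoly K a).natDegree = Module.finrank K L := by
  rw [← Field.primitive_element_iff_minpoly_natDegree_eq,
    Field.primitive_element_iff_algHom_eq_of_eval' K L (fun x => Normal.splits inferInstance x)]
  intro σ τ hst
  have := h (AlgEquiv.ofBijective σ (Algebra.IsAlgebraic.algHom_bijective σ))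
    (AlgEquiv.ofBijective τ (Algebra.IsAlgebraic.algHom_bijective τ)) hst
  ext x
  exact congrArg (fun ρ : L ≃ₐ[K] L => ρ x) this

theorem aeval_sum_C_mul_X_pow {K L : Type*} [Field K] [Field L] [Algebra K L] {n : ℕ}
    (c : Fin n → K) (γ : L) :
    aeval γ (∑ i : Fin n, C (c i) * X ^ (i : ℕ)) = ∑ i, c i • γ ^ (i : ℕ) := by
  simp [Algebra.smul_def]

/-! ### Conjugates of a generator of the multiplicative group of a finite field -/

theorem exists_algEquiv_eq_pow {K L : Type*} [Field K] [Finite K] [Field L] [Finite L]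
    [Algebra K L] (σ : L ≃ₐ[K] L) :
    ∃ j < Module.finrank K L, ∀ x, σ x = x ^ Nat.card K ^ j := by
  have := Fintype.ofFinite K
  obtain ⟨j, hj⟩ := (FiniteField.bijective_frobeniusAlgEquivOfAlgebraic_pow K L).2 σ
  refine ⟨j, j.2, fun x => ?_⟩
  rw [← hj]
  simp only [AlgEquiv.coe_pow, FiniteField.coe_frobeniusAlgEquivOfAlgebraic_iterate,
    Nat.card_eq_fintype_card]

section Generator

set_option linter.unusedSectionVars false

variable {K L : Type*} [Field K] [Finite K] [Field L] [Finite L] [Algebra K L] {α : Lˣ}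

theorem algEquiv_ext_generator (hα : ∀ x : Lˣ, x ∈ Subgroup.zpowers α) {σ τ : L ≃ₐ[K] L}
    (h : σ (α : L) = τ α) : σ = τ := by
  ext x
  by_cases hx : x = 0
  · simp [hx]
  · obtain ⟨k, hk⟩ := hα (Units.mk0 x hx)
    have : x = (α : L) ^ k := by
      rw [← Units.val_zpow_eq_zpow_val]; exact (congrArg Units.val hk).symm
    rw [this, map_zpow₀, map_zpow₀, h]

theorem orderOf_generator (hα : ∀ x : Lˣ, x ∈ Subgroup.zpowers α) :
    orderOf α = Nat.card L - 1 := by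
  rw [orderOf_eq_card_of_forall_mem_zpowers hα, Nat.card_units]

theorem three_mul_pow_le (hodd : Odd (Nat.card K)) {j : ℕ} (hj : j < Module.finrank K L) :
    3 * Nat.card K ^ j ≤ Nat.card L := by
  have h1 : 1 < Nat.card K := Finite.one_lt_card
  have h3 : 3 ≤ Nat.card K := by
    obtain ⟨k, hk⟩ := hodd; omega
  rw [Module.natCard_eq_pow_finrank (K := K) (V := L)]
  calc 3 * Nat.card K ^ j ≤ Nat.card K * Nat.card K ^ j := Nat.mul_le_mul_right _ h3
    _ = Nat.card K ^ (j + 1) := by rw [pow_succ']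
    _ ≤ _ := Nat.pow_le_pow_right (by omega) hj

/-- If `x ↦ x^(q^j)` fixes `α²`, then `|L| - 1` divides `2(q^j - 1)`. As `3 q^j ≤ |L|`, that number
is too small unless it is `0`. -/
theorem algEquiv_ext_generator_sq (hα : ∀ x : Lˣ, x ∈ Subgroup.zpowers α)
    (hodd : Odd (Nat.card K)) {σ τ : L ≃ₐ[K] L}
    (h : σ ((α : L) ^ 2) = τ ((α : L) ^ 2)) : σ = τ := by
  have key : ∀ ρ : L ≃ₐ[K] L, ρ ((α : L) ^ 2) = (α : L) ^ 2 → ρ = 1 := by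
    intro ρ hρ
    obtain ⟨j, hj, hρj⟩ := exists_algEquiv_eq_pow ρ
    have h3 := three_mul_pow_le (L := L) hodd hj
    have hpos : 0 < Nat.card K ^ j := pow_pos Nat.card_pos _
    have h2 : α ^ (2 * (Nat.card K ^ j - 1)) = 1 := by
      have h4 : α ^ (2 * (Nat.card K ^ j - 1)) * α ^ 2 = 1 * α ^ 2 := by
        rw [← pow_add, one_mul]
        ext
        push_cast
        rw [← hρ, hρj, ← pow_mul]
        congr 1
        omega
      exact mul_right_cancel h4
    rw [← orderOf_dvd_iff_pow_eq_one, orderOf_generator hα] at h2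
    have h5 : Nat.card K ^ j = 1 := by
      by_contra hne
      have := Nat.le_of_dvd (by omega) h2
      omega
    ext x
    rw [hρj, h5, pow_one, AlgEquiv.one_apply]
  have := key (τ⁻¹ * σ) (by rw [AlgEquiv.mul_apply, h]; exact τ.symm_apply_apply _)
  rw [inv_mul_eq_one] at this
  exact this.symm

/-- Conjugacy would give `α^(q^j) = α²` with both exponents below the order of `α`, so `q^j = 2`,
against oddness. -/
theorem algEquiv_generator_ne_sq (hα : ∀ x : Lˣ, x ∈ Subgroup.zpowers α)
    (hodd : Odd (Nat.card K)) (hL : 3 < Nat.card L) (σ τ : L ≃ₐ[K] L) :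
    σ (α : L) ≠ τ ((α : L) ^ 2) := by
  intro h
  have h1 : (τ⁻¹ * σ) (α : L) = (α : L) ^ 2 := by
    rw [AlgEquiv.mul_apply, h]; exact τ.symm_apply_apply _
  obtain ⟨j, hj, hρj⟩ := exists_algEquiv_eq_pow (τ⁻¹ * σ)
  have h3 := three_mul_pow_le (L := L) hodd hj
  rw [hρj] at h1
  have h2 : α ^ Nat.card K ^ j = α ^ 2 := by ext; push_cast; exact h1
  have h4 : Nat.card K ^ j = 2 := pow_injOn_Iio_orderOf (x := α)
    (by rw [Set.mem_Iio, orderOf_generator hα]; omega)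
    (by rw [Set.mem_Iio, orderOf_generator hα]; omega) h2
  have := hodd.pow (n := j)
  rw [h4] at this
  exact absurd this (by decide)

/-- This excludes the field of three elements, whose generator is `-1`. -/
theorem generator_sq_ne_one (hα : ∀ x : Lˣ, x ∈ Subgroup.zpowers α)
    (hL : 3 < Nat.card L) : (α : L) ^ 2 ≠ 1 := by
  intro h
  have h2 : α ^ 2 = 1 := by ext; push_cast; exact h
  rw [← orderOf_dvd_iff_pow_eq_one, orderOf_generator hα] at h2
  have := Nat.le_of_dvd (by omega) h2
  omega

theorem unit_pow_card_sub_one (γ : Lˣ) : γ ^ (Nat.card L - 1) = 1 := by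
  rw [← Nat.card_units]; exact pow_card_eq_one'

open Classical in
theorem geom_sum_unit (δ : Lˣ) :
    ∑ i ∈ Finset.range (Nat.card L - 1), (δ : L) ^ i = if δ = 1 then -1 else 0 := by
  have := Fintype.ofFinite L
  split_ifs with h
  · subst h
    have hL : 1 ≤ Nat.card L := Nat.card_pos
    simp only [Units.val_one, one_pow, Finset.sum_const, Finset.card_range, nsmul_eq_mul, mul_one]
    rw [Nat.cast_sub hL, Nat.card_eq_fintype_card, FiniteField.cast_card_eq_zero]
    simp
  · have h1 : (δ : L) ≠ 1 := fun h' => h (Units.ext h')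
    rw [geom_sum_eq h1, ← Units.val_pow_eq_pow_val, unit_pow_card_sub_one]
    simp

open Classical in
theorem aeval_seqPoly (α γ : Lˣ) :
    aeval (γ : L) (seqPoly (definingSeq K (fun x : L => x ^ 2) (α : L)) (Nat.card L - 1)) =
      -((∑ σ : L ≃ₐ[K] L, if σ ((α : L) ^ 2) * γ = 1 then 1 else 0) +
        2 * (∑ σ : L ≃ₐ[K] L, if σ (α : L) * γ = 1 then 1 else 0) +
        (Module.finrank K L : L) * if (γ : L) = 1 then 1 else 0) := by
  have key : ∀ δ : L, δ ≠ 0 → (∑ i ∈ Finset.range (Nat.card L - 1), δ ^ i) =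
      -(if δ = 1 then 1 else 0) := by
    intro δ hδ
    have := geom_sum_unit (Units.mk0 δ hδ)
    rw [Units.val_mk0] at this
    rw [this]
    simp [← Units.val_inj, neg_ite]
  have hσ : ∀ (σ : L ≃ₐ[K] L) (x : Lˣ), σ (x : L) * γ ≠ 0 := fun σ x =>
    mul_ne_zero ((map_ne_zero σ).2 x.ne_zero) γ.ne_zero
  have h1 : aeval (γ : L) (seqPoly (definingSeq K (fun x : L => x ^ 2) (α : L))
      (Nat.card L - 1)) = ∑ σ : L ≃ₐ[K] L,
        ((∑ i ∈ Finset.range (Nat.card L - 1), (σ ((α : L) ^ 2) * γ) ^ i) +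
        2 * (∑ i ∈ Finset.range (Nat.card L - 1), (σ (α : L) * γ) ^ i) +
        ∑ i ∈ Finset.range (Nat.card L - 1), (γ : L) ^ i) := by
    simp only [seqPoly, definingSeq, map_sum, map_mul, aeval_C, map_pow, aeval_X,
      trace_eq_sum_automorphisms, Finset.sum_mul, Finset.mul_sum, ← Finset.sum_add_distrib]
    rw [Finset.sum_comm]
    refine Finset.sum_congr rfl fun σ _ => Finset.sum_congr rfl fun i _ => ?_
    simp only [map_add, map_pow, map_one]
    ring
  rw [h1]
  have h2 : ∀ σ : L ≃ₐ[K] L, σ ((α : L) ^ 2) * γ ≠ 0 := fun σ => by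
    have := hσ σ (α ^ 2); rwa [Units.val_pow_eq_pow_val] at this
  simp only [key _ (h2 _), key _ (hσ _ α), key _ γ.ne_zero, Finset.sum_add_distrib,
    Finset.sum_const, Finset.card_univ, nsmul_eq_mul, ← Finset.mul_sum, Finset.sum_neg_distrib]
  rw [← Nat.card_eq_fintype_card, IsGalois.card_aut_eq_finrank]
  ring

theorem isConj_inv_iff (a γ : Lˣ) (σ : L ≃ₐ[K] L) : σ ((a⁻¹ : Lˣ) : L) = γ ↔ σ (a : L) * γ = 1 := by
  have h : σ ((a⁻¹ : Lˣ) : L) * σ (a : L) = 1 := by rw [← map_mul]; simp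
  constructor
  · intro h'; rw [← h', mul_comm, h]
  · intro h'
    have h0 : σ (a : L) ≠ 0 := (map_ne_zero σ).2 a.ne_zero
    apply mul_right_cancel₀ h0
    rw [h, mul_comm, h']

/-- The three conditions exclude one another, and each of the two Galois sums has at most one
nonzero term. The value is thus `0`, `-1`, `-2` or `-m`, without cancellation, and `2 ≠ 0` in odd
characteristic. -/
theorem aeval_seqPoly_ne_zero_iff (hα : ∀ x : Lˣ, x ∈ Subgroup.zpowers α)
    (hodd : Odd (Nat.card K)) (hL : 3 < Nat.card L) (γ : Lˣ) :
    aeval (γ : L) (seqPoly (definingSeq K (fun x : L => x ^ 2) (α : L)) (Nat.card L - 1)) ≠ 0 ↔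
      ((γ : L) = 1 ∧ (Module.finrank K L : L) ≠ 0) ∨
      (∃ σ : L ≃ₐ[K] L, σ ((α⁻¹ : Lˣ) : L) = γ) ∨
      ∃ σ : L ≃ₐ[K] L, σ (((α ^ 2)⁻¹ : Lˣ) : L) = γ := by
  classical
  have h2 : (2 : L) ≠ 0 := by
    have hodd' : Odd (Nat.card L) := by
      rw [Module.natCard_eq_pow_finrank (K := K) (V := L)]; exact hodd.pow
    have := Fintype.ofFinite L
    apply Ring.two_ne_zero
    intro h
    have := FiniteField.even_card_of_char_two h
    rw [← Nat.card_eq_fintype_card] at this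
    rw [Nat.odd_iff] at hodd'
    omega
  rw [aeval_seqPoly, neg_ne_zero]
  simp only [isConj_inv_iff, Units.val_pow_eq_pow_val]
  have hcancel : ∀ {x y : L}, x * γ = 1 → y * γ = 1 → x = y := fun h h' =>
    mul_right_cancel₀ γ.ne_zero (h.trans h'.symm)
  by_cases h1 : ∃ σ : L ≃ₐ[K] L, σ (α : L) * γ = 1
  · obtain ⟨σ, hσ⟩ := h1
    have ha : ∀ τ : L ≃ₐ[K] L, ¬ τ ((α : L) ^ 2) * γ = 1 := fun τ hτ =>
      algEquiv_generator_ne_sq hα hodd hL σ τ (hcancel hσ hτ)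
    have hb : ∀ τ : L ≃ₐ[K] L, τ (α : L) * γ = 1 ↔ τ = σ := fun τ =>
      ⟨fun hτ => algEquiv_ext_generator hα (hcancel hτ hσ), fun h => h ▸ hσ⟩
    have hc : ¬ (γ : L) = 1 := by
      intro h
      rw [h, mul_one] at hσ
      have : (α : L) = 1 := σ.injective (by rw [hσ, map_one])
      exact generator_sq_ne_one hα hL (by rw [this, one_pow])
    simp [ha, hb, hc, h2, -map_pow]
  · by_cases h3 : ∃ σ : L ≃ₐ[K] L, σ ((α : L) ^ 2) * γ = 1
    · obtain ⟨σ, hσ⟩ := h3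
      have hb : ∀ τ : L ≃ₐ[K] L, τ ((α : L) ^ 2) * γ = 1 ↔ τ = σ := fun τ =>
        ⟨fun hτ => algEquiv_ext_generator_sq hα hodd (hcancel hτ hσ), fun h => h ▸ hσ⟩
      have hc : ¬ (γ : L) = 1 := by
        intro h
        rw [h, mul_one] at hσ
        exact generator_sq_ne_one hα hL (σ.injective (by rw [hσ, map_one]))
      push Not at h1
      simp [h1, hb, hc, -map_pow]
    · push Not at h1 h3
      simp [h1, h3, -map_pow]

theorem not_isConjRoot_inv (a b : Lˣ) (h : ∀ σ : L ≃ₐ[K] L, σ (b : L) ≠ a) :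
    ¬ IsConjRoot K ((a⁻¹ : Lˣ) : L) ((b⁻¹ : Lˣ) : L) := by
  rw [isConjRoot_iff_exists_algEquiv]
  rintro ⟨σ, hσ⟩
  rw [isConj_inv_iff] at hσ
  exact h σ (by simpa [mul_inv_eq_one₀] using hσ)

theorem X_pow_card_sub_one_separable : (X ^ (Nat.card L - 1) - 1 : K[X]).Separable := by
  -- In `L` this number equals `-1`: it is the geometric sum with ratio `1`.
  have h : ((Nat.card L - 1 : ℕ) : L) ≠ 0 := by
    have := geom_sum_unit (1 : Lˣ)
    simp only [Units.val_one, one_pow, Finset.sum_const, Finset.card_range, nsmul_eq_mul,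
      mul_one, if_true] at this
    rw [this]; simp
  refine Polynomial.X_pow_sub_one_separable_iff.2 fun h' => h ?_
  rw [← map_natCast (algebraMap K L), h', map_zero]

theorem X_pow_card_sub_one_splits (hα : ∀ x : Lˣ, x ∈ Subgroup.zpowers α) :
    ((X ^ (Nat.card L - 1) - 1 : K[X]).map (algebraMap K L)).Splits := by
  have h := IsPrimitiveRoot.orderOf α
  rw [orderOf_generator hα] at h
  have := X_pow_sub_one_splits (IsPrimitiveRoot.coe_units_iff.2 h)
  simpa using this

end Generator

/-! ### The generator polynomial -/

section GeneratorPoly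

set_option linter.unusedSectionVars false

variable {K L : Type*} [Field K] [Finite K] [Field L] [Finite L] [Algebra K L] {α : Lˣ}

/-- `X - 1` to the power `ε`, times the minimal polynomials of `α⁻¹` and `α⁻²`. -/
noncomputable def squareSeqGenPoly (K : Type*) {L : Type*} [Field K] [Field L] [Algebra K L]
    (α : Lˣ) (ε : ℕ) : K[X] :=
  (X - 1) ^ ε * minpoly K ((α⁻¹ : Lˣ) : L) * minpoly K (((α ^ 2)⁻¹ : Lˣ) : L)

theorem isCoprime_factors (hα : ∀ x : Lˣ, x ∈ Subgroup.zpowers α)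
    (hodd : Odd (Nat.card K)) (hL : 3 < Nat.card L) :
    IsCoprime (minpoly K ((α⁻¹ : Lˣ) : L)) (minpoly K (((α ^ 2)⁻¹ : Lˣ) : L)) ∧
    IsCoprime (X - 1) (minpoly K ((α⁻¹ : Lˣ) : L)) ∧
    IsCoprime (X - 1) (minpoly K (((α ^ 2)⁻¹ : Lˣ) : L)) := by
  have h1 : (X - 1 : K[X]) = minpoly K (((1 : Lˣ)⁻¹ : Lˣ) : L) := by
    rw [inv_one, Units.val_one, minpoly.one]
  have hsq := generator_sq_ne_one hα hL
  rw [h1]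
  refine ⟨isCoprime_minpoly (not_isConjRoot_inv _ _ fun σ h => ?_),
    isCoprime_minpoly (not_isConjRoot_inv _ _ fun σ h => ?_),
    isCoprime_minpoly (not_isConjRoot_inv _ _ fun σ h => ?_)⟩
  · exact algEquiv_generator_ne_sq hα hodd hL 1 σ (by simpa using h.symm)
  · have : (α : L) = 1 := σ.injective (by rw [h, Units.val_one, map_one])
    exact hsq (by rw [this, one_pow])
  · exact hsq (σ.injective (by rw [← Units.val_pow_eq_pow_val, h, Units.val_one, map_one]))

theorem squareSeqGenPoly_monic (ε : ℕ) : (squareSeqGenPoly K α ε).Monic := by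
  have h := fun a : L => minpoly.monic (Algebra.IsIntegral.isIntegral (R := K) a)
  have h1 : (X - 1 : K[X]).Monic := by simpa using monic_X_sub_C (1 : K)
  exact ((h1.pow ε).mul (h _)).mul (h _)

theorem squareSeqGenPoly_dvd_iff (hα : ∀ x : Lˣ, x ∈ Subgroup.zpowers α)
    (hodd : Odd (Nat.card K)) (hL : 3 < Nat.card L) {ε : ℕ} (hε : ε ≤ 1) (f : K[X]) :
    squareSeqGenPoly K α ε ∣ f ↔ (ε = 1 → aeval (1 : L) f = 0) ∧
      aeval ((α⁻¹ : Lˣ) : L) f = 0 ∧ aeval (((α ^ 2)⁻¹ : Lˣ) : L) f = 0 := by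
  obtain ⟨h1, h2, h3⟩ := isCoprime_factors hα hodd hL
  have hone : (ε = 1 → aeval (1 : L) f = 0) ↔ (X - 1) ^ ε ∣ f := by
    obtain rfl | rfl : ε = 0 ∨ ε = 1 := by omega
    · simp
    · rw [pow_one, ← minpoly.one (A := K) (B := L), minpoly.dvd_iff]; simp
  rw [hone, ← minpoly.dvd_iff, ← minpoly.dvd_iff]
  constructor
  · intro h
    exact ⟨((dvd_mul_right _ _).mul_right _).trans h,
      ((dvd_mul_left _ _).mul_right _).trans h, (dvd_mul_left _ _).trans h⟩
  · rintro ⟨ha, hb, hc⟩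
    exact ((h3.pow_left.mul_left h1).mul_dvd (h2.pow_left.mul_dvd ha hb) hc)

theorem squareSeqGenPoly_natDegree (hα : ∀ x : Lˣ, x ∈ Subgroup.zpowers α)
    (hodd : Odd (Nat.card K)) (ε : ℕ) :
    (squareSeqGenPoly K α ε).natDegree = 2 * Module.finrank K L + ε := by
  have h := fun a : L => minpoly.monic (Algebra.IsIntegral.isIntegral (R := K) a)
  have h1 : (X - 1 : K[X]).Monic := by simpa using monic_X_sub_C (1 : K)
  have h2 : (X - 1 : K[X]).natDegree = 1 := by simpa using natDegree_X_sub_C (1 : K)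
  have hinv : ∀ (a : Lˣ), (∀ σ τ : L ≃ₐ[K] L, σ (a : L) = τ a → σ = τ) →
      (minpoly K ((a⁻¹ : Lˣ) : L)).natDegree = Module.finrank K L := fun a ha =>
    natDegree_minpoly_of_injective fun σ τ h => ha σ τ (by simpa using h)
  rw [squareSeqGenPoly, ((h1.pow ε).mul (h _)).natDegree_mul (h _),
    (h1.pow ε).natDegree_mul (h _), h1.natDegree_pow, h2,
    hinv α (fun σ τ => algEquiv_ext_generator hα),
    hinv (α ^ 2) (fun σ τ h => algEquiv_ext_generator_sq hα hodd
      (by simpa only [Units.val_pow_eq_pow_val] using h))]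
  ring

theorem aeval_X_pow_card_sub_one (γ : Lˣ) :
    aeval (γ : L) (X ^ (Nat.card L - 1) - 1 : K[X]) = 0 := by
  rw [map_sub, map_pow, aeval_X, map_one, ← Units.val_pow_eq_pow_val, unit_pow_card_sub_one]
  simp

theorem squareSeqGenPoly_dvd (hα : ∀ x : Lˣ, x ∈ Subgroup.zpowers α)
    (hodd : Odd (Nat.card K)) (hL : 3 < Nat.card L) {ε : ℕ} (hε : ε ≤ 1) :
    squareSeqGenPoly K α ε ∣ X ^ (Nat.card L - 1) - 1 := by
  rw [squareSeqGenPoly_dvd_iff hα hodd hL hε]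
  exact ⟨fun _ => by simp,
    aeval_X_pow_card_sub_one _, aeval_X_pow_card_sub_one _⟩

theorem aeval_squareSeqGenPoly_eq_zero_iff {ε : ℕ} (hε : ε ≤ 1) (γ : L) :
    aeval γ (squareSeqGenPoly K α ε) = 0 ↔ (γ = 1 ∧ ε = 1) ∨
      (∃ σ : L ≃ₐ[K] L, σ ((α⁻¹ : Lˣ) : L) = γ) ∨
      ∃ σ : L ≃ₐ[K] L, σ (((α ^ 2)⁻¹ : Lˣ) : L) = γ := by
  rw [squareSeqGenPoly, map_mul, map_mul, mul_eq_zero, mul_eq_zero, aeval_minpoly_eq_zero_iff,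
    aeval_minpoly_eq_zero_iff, or_assoc]
  obtain rfl | rfl : ε = 0 ∨ ε = 1 := by omega
  · simp
  · simp [sub_eq_zero]

/-- The polynomial `h` is the normalized gcd. By Bézout its zeros among the `n`-th roots of unity
are exactly those of `S`. -/
theorem seqGenPoly_spec {K : Type*} [Field K] (s : ℕ → K) {n : ℕ}
    (hn : 0 < n) : (seqGenPoly s n).Monic ∧ ∃ h : K[X], h * seqGenPoly s n = X ^ n - 1 ∧
      ∀ {L : Type*} [Field L] [Algebra K L] (γ : L), γ ^ n = 1 →
        (aeval γ h = 0 ↔ aeval γ (seqPoly s n) = 0) := by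
  classical
  have hmon : (X ^ n - 1 : K[X]).Monic := by simpa using monic_X_pow_sub_C (1 : K) hn.ne'
  set d := EuclideanDomain.gcd (seqPoly s n) (X ^ n - 1) with hd
  have hd0 : d ≠ 0 := fun h => hmon.ne_zero (EuclideanDomain.gcd_eq_zero_iff.1 h).2
  have hdvd : normalize d ∣ X ^ n - 1 := normalize_dvd_iff.2 (EuclideanDomain.gcd_dvd_right _ _)
  have hmul : normalize d * seqGenPoly s n = X ^ n - 1 := by
    have h := EuclideanDomain.mul_div_cancel' (normalize_eq_zero.not.2 hd0) hdvd
    rw [← h, seqGenPoly]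
  refine ⟨(monic_normalize hd0).of_mul_monic_left (by rw [hmul]; exact hmon),
    normalize d, hmul, fun {L} _ _ γ hγ => ?_⟩
  have h1 : aeval γ (X ^ n - 1 : K[X]) = 0 := by simp [hγ]
  constructor
  · intro h
    have : normalize d ∣ seqPoly s n := normalize_dvd_iff.2 (EuclideanDomain.gcd_dvd_left _ _)
    exact aeval_eq_zero_of_dvd_aeval_eq_zero this h
  · intro h
    refine aeval_eq_zero_of_dvd_aeval_eq_zero (dvd_normalize_iff.2 dvd_rfl) ?_ (p := d)
    rw [hd, EuclideanDomain.gcd_eq_gcd_ab, map_add, map_mul, map_mul, h, h1]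
    simp

/-- Both sides are monic divisors of a separable polynomial split over `L`, so comparing roots
suffices. A root of `x^n - 1` is a root of the cofactor exactly when the gcd, equivalently `S`, does
not vanish there. -/
theorem seqGenPoly_eq (hα : ∀ x : Lˣ, x ∈ Subgroup.zpowers α)
    (hodd : Odd (Nat.card K)) (hL : 3 < Nat.card L) {ε : ℕ} (hε : ε ≤ 1)
    (hε' : ε = 1 ↔ (Module.finrank K L : L) ≠ 0) :
    seqGenPoly (definingSeq K (fun x : L => x ^ 2) (α : L)) (Nat.card L - 1) =
      squareSeqGenPoly K α ε := by
  obtain ⟨hmon, h, hmul, hh⟩ := seqGenPoly_spec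
    (definingSeq K (fun x : L => x ^ 2) (α : L)) (n := Nat.card L - 1) (by omega)
  set g' := seqGenPoly (definingSeq K (fun x : L => x ^ 2) (α : L)) (Nat.card L - 1)
  have hsep := X_pow_card_sub_one_separable (K := K) (L := L)
  have hspl := X_pow_card_sub_one_splits (K := K) hα
  have hg' : g' ∣ X ^ (Nat.card L - 1) - 1 := ⟨h, by rw [← hmul, mul_comm]⟩
  have hg := squareSeqGenPoly_dvd (K := K) hα hodd hL hε
  have hroot : ∀ γ : Lˣ, aeval (γ : L) g' = 0 ↔ aeval (γ : L) (squareSeqGenPoly K α ε) = 0 := by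
    intro γ
    have hγ : (γ : L) ^ (Nat.card L - 1) = 1 := by
      rw [← Units.val_pow_eq_pow_val, unit_pow_card_sub_one, Units.val_one]
    rw [aeval_squareSeqGenPoly_eq_zero_iff hε, hε', ← aeval_seqPoly_ne_zero_iff hα hodd hL,
      ← (hh (γ : L) hγ).ne]
    have h0 := aeval_X_pow_card_sub_one (K := K) γ
    rw [← hmul, map_mul, mul_eq_zero] at h0
    constructor
    · intro h1 h2
      -- Separability makes `h` and `g'` coprime, so they share no root.
      rw [← hmul] at hsep
      obtain ⟨a, b, hab⟩ := hsep.isCoprime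
      have := congrArg (aeval (γ : L)) hab
      simp [h1, h2] at this
    · exact h0.resolve_left
  have hunit : ∀ {f : K[X]}, f ∣ X ^ (Nat.card L - 1) - 1 → ∀ γ : L, aeval γ f = 0 →
      ∃ u : Lˣ, (u : L) = γ := by
    intro f hf γ hγ
    refine ⟨Units.mk0 γ ?_, rfl⟩
    rintro rfl
    have := aeval_eq_zero_of_dvd_aeval_eq_zero hf hγ
    simp [show Nat.card L - 1 ≠ 0 by omega] at this
  refine eq_of_monic_of_associated hmon (squareSeqGenPoly_monic ε) (associated_of_dvd_dvd ?_ ?_)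
  · refine dvd_of_forall_root hsep hspl hg' fun γ hγ => ?_
    obtain ⟨u, rfl⟩ := hunit hg' γ hγ
    exact (hroot u).1 hγ
  · refine dvd_of_forall_root hsep hspl hg fun γ hγ => ?_
    obtain ⟨u, rfl⟩ := hunit hg γ hγ
    exact (hroot u).2 hγ

/-- The codewords are the solutions of the parity checks given by the powers of `α⁻¹`. -/
theorem mem_squareSeqCode (hα : ∀ x : Lˣ, x ∈ Subgroup.zpowers α)
    (hodd : Odd (Nat.card K)) (hL : 3 < Nat.card L) {ε : ℕ} (hε : ε ≤ 1)
    (c : Fin (Nat.card L - 1) → K) :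
    c ∈ codeOfPoly (Nat.card L - 1) (squareSeqGenPoly K α ε) ↔ (ε = 1 → ∑ i, c i = 0) ∧
      ∑ i, c i • ((α⁻¹ ^ (i : ℕ) : Lˣ) : L) = 0 ∧
      ∑ i, c i • ((α⁻¹ ^ (i : ℕ) : Lˣ) : L) ^ 2 = 0 := by
  rw [mem_codeOfPoly (squareSeqGenPoly_dvd hα hodd hL hε), squareSeqGenPoly_dvd_iff hα hodd hL hε,
    aeval_sum_C_mul_X_pow, aeval_sum_C_mul_X_pow, aeval_sum_C_mul_X_pow]
  simp only [one_pow, ← Finset.sum_smul, Units.val_pow_eq_pow_val, ← pow_mul, ← inv_pow,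
    smul_eq_zero, one_ne_zero, or_false, mul_comm]

end GeneratorPoly

/-! ### The minimum distance -/

section Distance

variable {K L : Type*} [Field K] [Field L] [Algebra K L]

/-- `𝒞` is the code of all words satisfying the parity checks `y` and `y ^ 2`, and the sum check
if `ε = 1`, where `y` runs through the nonzero elements of `L`. -/
def IsSquareCheckCode {n : ℕ} (e : Fin n ≃ Lˣ) (ε : ℕ) (𝒞 : Submodule K (Fin n → K)) : Prop :=
  ∀ c, c ∈ 𝒞 ↔ (ε = 1 → ∑ i, c i = 0) ∧
    ∑ i, c i • (e i : L) = 0 ∧ ∑ i, c i • (e i : L) ^ 2 = 0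

variable {n : ℕ} {e : Fin n ≃ Lˣ} {ε : ℕ} {𝒞 : Submodule K (Fin n → K)}

/-- Linear relations among `k` distinct points become codewords; the weight is only bounded by `k`
since some coefficients may vanish. -/
theorem IsSquareCheckCode.exists_word (h : IsSquareCheckCode e ε 𝒞) [DecidableEq K] {k : ℕ}
    {y : Fin k → L} (hy : Function.Injective y) (hy0 : ∀ j, y j ≠ 0) {a : Fin k → K} (ha : a ≠ 0)
    (h0 : ε = 1 → ∑ j, a j = 0) (h1 : ∑ j, a j • y j = 0) (h2 : ∑ j, a j • y j ^ 2 = 0) :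
    ∃ c ∈ 𝒞, c ≠ 0 ∧ hammingNorm c ≤ k := by
  classical
  let u : Fin k → Fin n := fun j => e.symm (Units.mk0 (y j) (hy0 j))
  have hu : Function.Injective u := fun i j hij => hy (by simpa [u] using hij)
  have heu : ∀ j, (e (u j) : L) = y j := fun j => by simp [u]
  let c : Fin n → K := ∑ j, Pi.single (u j) (a j)
  have hc : ∀ i, c i = ∑ j, if i = u j then a j else 0 := fun i => by
    simp [c, Finset.sum_apply, Pi.single_apply]
  have hsum : ∀ f : Fin n → L, ∑ i, c i • f i = ∑ j, a j • f (u j) := by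
    intro f
    simp only [hc, Finset.sum_smul]
    rw [Finset.sum_comm]
    simp [ite_smul]
  have hcu : ∀ j, c (u j) = a j := fun j => by simp [hc, hu.eq_iff]
  refine ⟨c, (h c).2 ⟨fun hε => ?_, ?_, ?_⟩, ?_, ?_⟩
  · simp only [hc]
    rw [Finset.sum_comm]
    simpa using h0 hε
  · rw [hsum]; simpa only [heu] using h1
  · rw [hsum (fun i => (e i : L) ^ 2)]; simpa only [heu] using h2
  · intro hc0
    apply ha
    ext j
    rw [← hcu, hc0]
    rfl
  · have hsub : Finset.univ.filter (fun i => c i ≠ 0) ⊆ Finset.univ.image u := by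
      intro i hi
      rw [Finset.mem_filter] at hi
      by_contra hni
      apply hi.2
      rw [hc]
      refine Finset.sum_eq_zero fun j _ => if_neg fun hij => hni ?_
      exact Finset.mem_image.2 ⟨j, Finset.mem_univ _, hij.symm⟩
    calc hammingNorm c = (Finset.univ.filter (fun i => c i ≠ 0)).card := rfl
      _ ≤ (Finset.univ.image u).card := Finset.card_le_card hsub
      _ ≤ _ := Finset.card_image_le.trans (by simp)

theorem sum_smul_eq_sum_filter [DecidableEq K] (c : Fin n → K) (f : Fin n → L) :
    ∑ i, c i • f i = ∑ i ∈ Finset.univ.filter (fun i => c i ≠ 0), c i • f i := by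
  rw [Finset.sum_filter_of_ne]
  intro i _ h hc
  rw [hc, zero_smul] at h
  exact h rfl

theorem IsSquareCheckCode.three_le_hammingNorm (h : IsSquareCheckCode e ε 𝒞) [DecidableEq K]
    {c : Fin n → K} (hc : c ∈ 𝒞) (hc0 : c ≠ 0) : 3 ≤ hammingNorm c := by
  obtain ⟨-, h1, h2⟩ := (h c).1 hc
  rw [sum_smul_eq_sum_filter c (fun i => (e i : L))] at h1
  rw [sum_smul_eq_sum_filter c (fun i => (e i : L) ^ 2)] at h2
  have hpos : hammingNorm c ≠ 0 := fun h => hc0 (hammingNorm_eq_zero.1 h)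
  have hmem : ∀ i, i ∈ Finset.univ.filter (fun i => c i ≠ 0) → algebraMap K L (c i) ≠ 0 :=
    fun i hi => (_root_.map_ne_zero _).2 (Finset.mem_filter.1 hi).2
  change 3 ≤ (Finset.univ.filter (fun i => c i ≠ 0)).card
  change (Finset.univ.filter (fun i => c i ≠ 0)).card ≠ 0 at hpos
  set s := Finset.univ.filter (fun i => c i ≠ 0) with hs
  clear_value s
  by_contra! hlt
  obtain h3 | h3 : s.card = 1 ∨ s.card = 2 := by omega
  · obtain ⟨i, rfl⟩ := Finset.card_eq_one.1 h3
    rw [Finset.sum_singleton, Algebra.smul_def] at h1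
    exact mul_ne_zero (hmem i (by simp)) (e i).ne_zero h1
  · obtain ⟨i, j, hij, rfl⟩ := Finset.card_eq_two.1 h3
    rw [Finset.sum_pair hij, Algebra.smul_def, Algebra.smul_def] at h1 h2
    have hi := mul_ne_zero (hmem i (by simp)) (e i).ne_zero
    have hne : (e i : L) - e j ≠ 0 := sub_ne_zero.2 fun h => hij (e.injective (Units.ext h))
    -- Eliminating the `j` term from the two checks leaves `c_i y_i (y_i - y_j) = 0`.
    exact mul_ne_zero hi hne (by linear_combination h2 - (e j : L) * h1)

/-- Up to a global sign and the order of the terms there are two patterns. If `x + y + z = 0`, the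
squares sum to `2(x - y)²` modulo 3; if `x + y = z`, then `x² + y² = z²` forces `2xy = 0`. -/
theorem no_three_term_relation (h3 : (3 : L) = 0) {x y z a b c : L} (hx : x ≠ 0)
    (hy : y ≠ 0) (hz : z ≠ 0) (hxy : x ≠ y) (ha : a = 1 ∨ a = -1) (hb : b = 1 ∨ b = -1)
    (hc : c = 1 ∨ c = -1) (h1 : a * x + b * y + c * z = 0)
    (h2 : a * x ^ 2 + b * y ^ 2 + c * z ^ 2 = 0) : False := by
  have h2' : (2 : L) ≠ 0 := fun h => one_ne_zero (α := L) (by linear_combination h3 - h)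
  have e1 : ∀ {x y z : L}, x ≠ y → x + y + z = 0 → x ^ 2 + y ^ 2 + z ^ 2 = 0 → False := by
    intro x y z hxy h1 h2
    have : 2 * (x - y) ^ 2 = 0 := by
      linear_combination h2 - (z - x - y) * h1 - 2 * x * y * h3
    exact mul_ne_zero h2' (pow_ne_zero 2 (sub_ne_zero.2 hxy)) this
  have e2 : ∀ {x y z : L}, x ≠ 0 → y ≠ 0 → x + y - z = 0 → x ^ 2 + y ^ 2 - z ^ 2 = 0 → False := by
    intro x y z hx hy h1 h2
    have : 2 * (x * y) = 0 := by linear_combination (x + y + z) * h1 - h2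
    exact mul_ne_zero h2' (mul_ne_zero hx hy) this
  rcases ha with rfl | rfl <;> rcases hb with rfl | rfl <;> rcases hc with rfl | rfl
  · exact e1 hxy (z := z) (by linear_combination h1) (by linear_combination h2)
  · exact e2 hx hy (z := z) (by linear_combination h1) (by linear_combination h2)
  · exact e2 hx hz (z := y) (by linear_combination h1) (by linear_combination h2)
  · exact e2 hy hz (z := x) (by linear_combination -h1) (by linear_combination -h2)
  · exact e2 hy hz (z := x) (by linear_combination h1) (by linear_combination h2)
  · exact e2 hx hz (z := y) (by linear_combination -h1) (by linear_combination -h2)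
  · exact e2 hx hy (z := z) (by linear_combination -h1) (by linear_combination -h2)
  · exact e1 hxy (z := z) (by linear_combination -h1) (by linear_combination -h2)

theorem three_eq_zero_of_card {K : Type*} [Field K] (hK : Nat.card K = 3) : (3 : K) = 0 := by
  have : Finite K := Nat.finite_of_card_ne_zero (by omega)
  have := Fintype.ofFinite K
  have h3 := FiniteField.cast_card_eq_zero K
  rw [← Nat.card_eq_fintype_card, hK] at h3
  exact_mod_cast h3

theorem IsSquareCheckCode.four_le_hammingNorm (h : IsSquareCheckCode e ε 𝒞) [DecidableEq K]
    (hK : Nat.card K = 3) {c : Fin n → K} (hc : c ∈ 𝒞) (hc0 : c ≠ 0) : 4 ≤ hammingNorm c := by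
  have h3 : (3 : L) = 0 := by
    rw [← map_ofNat (algebraMap K L) 3, three_eq_zero_of_card hK, map_zero]
  have : Finite K := Nat.finite_of_card_ne_zero (by omega)
  have := Fintype.ofFinite K
  rw [Nat.card_eq_fintype_card] at hK
  have hsign : ∀ x : K, x ≠ 0 → algebraMap K L x = 1 ∨ algebraMap K L x = -1 := by
    intro x hx
    have hx2 := FiniteField.pow_card_sub_one_eq_one x hx
    rw [hK] at hx2
    obtain rfl | rfl := eq_or_eq_neg_of_sq_eq_sq x 1 (hx2.trans (one_pow 2).symm) <;> simp
  obtain ⟨-, h1, h2⟩ := (h c).1 hc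
  rw [sum_smul_eq_sum_filter c (fun i => (e i : L))] at h1
  rw [sum_smul_eq_sum_filter c (fun i => (e i : L) ^ 2)] at h2
  refine Nat.lt_of_le_of_ne (h.three_le_hammingNorm hc hc0) fun hcard => ?_
  have hmem : ∀ i, i ∈ Finset.univ.filter (fun i => c i ≠ 0) → c i ≠ 0 :=
    fun i hi => (Finset.mem_filter.1 hi).2
  obtain ⟨i, j, k, hij, hik, hjk, hs⟩ := Finset.card_eq_three.1
    (show (Finset.univ.filter (fun i => c i ≠ 0)).card = 3 from hcard.symm)
  rw [hs] at h1 h2 hmem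
  have hsum : ∀ f : Fin n → L, ∑ l ∈ {i, j, k}, f l = f i + f j + f k := fun f => by
    rw [Finset.sum_insert (by simp [hij, hik]), Finset.sum_pair hjk, add_assoc]
  rw [hsum] at h1 h2
  simp only [Algebra.smul_def] at h1 h2
  exact no_three_term_relation h3 (e i).ne_zero (e j).ne_zero (e k).ne_zero
    (fun h => hij (e.injective (Units.ext h))) (hsign _ (hmem i (by simp)))
    (hsign _ (hmem j (by simp))) (hsign _ (hmem k (by simp))) h1 h2

/-- At points of `K` the checks are only two equations over `K`, or three if `ε = 1`, so one unknown
more gives a nonzero solution. -/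
theorem IsSquareCheckCode.exists_word_base (h : IsSquareCheckCode e ε 𝒞) [DecidableEq K]
    {k : ℕ} {s : Fin k → K} (hs : Function.Injective s) (hs0 : ∀ j, s j ≠ 0)
    (hk : 3 ≤ k) (hε : ε = 1 → 4 ≤ k) :
    ∃ c ∈ 𝒞, c ≠ 0 ∧ hammingNorm c ≤ k := by
  have main : ∃ a : Fin k → K, a ≠ 0 ∧ (ε = 1 → ∑ j, a j = 0) ∧ ∑ j, a j * s j = 0 ∧
      ∑ j, a j * s j ^ 2 = 0 := by
    by_cases h1 : ε = 1
    · let φ : (Fin k → K) →ₗ[K] (Fin 3 → K) :=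
        Matrix.mulVecLin (Matrix.of fun (r : Fin 3) j => s j ^ (r : ℕ))
      have := LinearMap.ker_ne_bot_of_finrank_lt (f := φ) (by simp; have := hε h1; omega)
      obtain ⟨a, ha, ha0⟩ := φ.ker.exists_mem_ne_zero_of_ne_bot this
      have hr : ∀ r : Fin 3, ∑ j, s j ^ (r : ℕ) * a j = 0 := fun r => congrFun ha r
      refine ⟨a, ha0, fun _ => ?_, ?_, ?_⟩
      · simpa using hr 0
      · simpa [mul_comm] using hr 1
      · simpa [mul_comm] using hr 2
    · let φ : (Fin k → K) →ₗ[K] (Fin 2 → K) :=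
        Matrix.mulVecLin (Matrix.of fun (r : Fin 2) j => s j ^ ((r : ℕ) + 1))
      have := LinearMap.ker_ne_bot_of_finrank_lt (f := φ) (by simp; omega)
      obtain ⟨a, ha, ha0⟩ := φ.ker.exists_mem_ne_zero_of_ne_bot this
      have hr : ∀ r : Fin 2, ∑ j, s j ^ ((r : ℕ) + 1) * a j = 0 := fun r => congrFun ha r
      refine ⟨a, ha0, fun h => absurd h h1, ?_, ?_⟩
      · simpa [mul_comm] using hr 0
      · simpa [mul_comm] using hr 1
  obtain ⟨a, ha, h0, h1, h2⟩ := main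
  refine h.exists_word (y := fun j => algebraMap K L (s j))
    ((algebraMap K L).injective.comp hs) (fun j => (_root_.map_ne_zero _).2 (hs0 j)) ha h0 ?_ ?_
  · simpa [Algebra.smul_def] using congrArg (algebraMap K L) h1
  · simpa [Algebra.smul_def] using congrArg (algebraMap K L) h2

/-- In characteristic `3`, four distinct nonzero elements with vanishing sum and sum of squares. -/
theorem exists_four_zero_sum (h3 : (3 : L) = 0) {u : L} (h0 : u ≠ 0) (h1 : u ≠ 1)
    (h2 : u ≠ -1) : ∃ y : Fin 4 → L, Function.Injective y ∧ (∀ j, y j ≠ 0) ∧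
      ∑ j, y j = 0 ∧ ∑ j, y j ^ 2 = 0 := by
  have hp : u + 1 ≠ 0 := fun h => h2 (eq_neg_of_add_eq_zero_left h)
  have hm : u - 1 ≠ 0 := sub_ne_zero.2 h1
  have hone := one_ne_zero (α := L)
  have e01 : u ^ 2 ≠ 1 := fun h => mul_ne_zero hp hm (by linear_combination h)
  have e02 : u ^ 2 ≠ (u + 1) ^ 2 := fun h => hm (by linear_combination h + u * h3)
  have e03 : u ^ 2 ≠ (u - 1) ^ 2 := fun h => hp (by linear_combination - h + u * h3)
  have e12 : 1 ≠ (u + 1) ^ 2 := fun h => mul_ne_zero h0 hm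
    (by linear_combination - h - u * h3)
  have e13 : 1 ≠ (u - 1) ^ 2 := fun h => mul_ne_zero h0 hp
    (by linear_combination - h + u * h3)
  have e23 : (u + 1) ^ 2 ≠ (u - 1) ^ 2 := fun h => h0 (by linear_combination h - u * h3)
  -- These are the squares of `u`, `1`, `u + 1`, `u - 1`, which represent, up to sign, the nonzero
  -- vectors of the plane spanned by `u` and `1` over the prime field. No two are equal or opposite,
  -- so their squares differ.
  refine ⟨![u ^ 2, 1, (u + 1) ^ 2, (u - 1) ^ 2], ?_, ?_, ?_, ?_⟩
  · intro i j hij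
    fin_cases i <;> fin_cases j <;> simp_all [eq_comm]
  · intro j
    fin_cases j <;> simp [h0, hp, hm]
  · simp only [Fin.sum_univ_four, Matrix.cons_val]
    linear_combination (u ^ 2 + 1) * h3
  · simp only [Fin.sum_univ_four, Matrix.cons_val]
    linear_combination (u ^ 4 + 4 * u ^ 2 + 1) * h3

theorem exists_not_mem_of_card_lt {α : Type*} [Finite α] (s : Finset α) (h : s.card < Nat.card α) :
    ∃ x, x ∉ s := by
  classical
  have := Fintype.ofFinite α
  rw [Nat.card_eq_fintype_card] at h
  by_contra! hs
  exact h.ne (by rw [Finset.eq_univ_iff_forall.2 hs, Finset.card_univ])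

theorem IsSquareCheckCode.exists_word_ternary (h : IsSquareCheckCode e ε 𝒞) [DecidableEq K]
    (hK : Nat.card K = 3) [Finite L] (hL : 5 < Nat.card L) (hε : ε ≤ 1) :
    ∃ c ∈ 𝒞, c ≠ 0 ∧ hammingNorm c ≤ 4 + ε := by
  classical
  have h3K := three_eq_zero_of_card hK
  have h3 : (3 : L) = 0 := by
    rw [← map_ofNat (algebraMap K L) 3, h3K, map_zero]
  obtain ⟨u, hu⟩ := exists_not_mem_of_card_lt ({0, 1, -1} : Finset L)
    ((Finset.card_le_three).trans_lt (by omega))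
  simp only [Finset.mem_insert, Finset.mem_singleton, not_or] at hu
  obtain ⟨y, hy, hy0, h1, h2⟩ := exists_four_zero_sum h3 hu.1 hu.2.1 hu.2.2
  obtain rfl | rfl : ε = 0 ∨ ε = 1 := by omega
  · exact h.exists_word hy hy0 (a := fun _ => 1) (fun h => one_ne_zero (congrFun h 0))
      (fun h => absurd h zero_ne_one) (by simpa using h1) (by simpa using h2)
  -- Translating by `t` must keep the four points nonzero, and `t` itself becomes the fifth point:
  -- five values to avoid, whence `5 < |L|`.
  · obtain ⟨t, ht⟩ := exists_not_mem_of_card_lt (insert 0 (Finset.univ.image fun j => -y j))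
      (((Finset.card_insert_le _ _).trans
        (Nat.add_le_add_right Finset.card_image_le 1)).trans_lt (by simpa using hL))
    simp only [Finset.mem_insert, Finset.mem_image, Finset.mem_univ, true_and, not_or,
      not_exists] at ht
    -- The coefficient `-1` at `t` turns the excesses `4`, `4t`, `4t²` in the three checks into `3`,
    -- `3t`, `3t²`, all zero.
    refine h.exists_word (k := 5) (y := Fin.cons t fun j => y j + t)
      (a := Fin.cons (-1) fun _ => 1) ?_ ?_ ?_ (fun _ => ?_) ?_ ?_
    · rw [Fin.cons_injective_iff]
      refine ⟨?_, fun i j hij => hy (add_right_cancel hij)⟩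
      rintro ⟨j, hj⟩
      exact hy0 j (by simpa using hj)
    · intro j
      refine Fin.cases ?_ (fun j => ?_) j
      · exact ht.1
      · exact fun hj => ht.2 j (neg_eq_of_add_eq_zero_right hj)
    · intro h
      simpa using congrFun h 0
    · simp only [Fin.sum_univ_succ, Fin.cons_zero, Fin.cons_succ, Finset.sum_const,
        Finset.card_univ, Fintype.card_fin]
      linear_combination h3K
    · rw [Fin.sum_univ_succ]
      simp only [Fin.cons_zero, Fin.cons_succ, one_smul, neg_smul, Finset.sum_add_distrib,
        Finset.sum_const, Finset.card_univ, Fintype.card_fin, nsmul_eq_mul]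
      push_cast
      linear_combination h1 + t * h3
    · rw [Fin.sum_univ_succ]
      simp only [Fin.cons_zero, Fin.cons_succ, one_smul, neg_smul, add_sq, Finset.sum_add_distrib,
        Finset.sum_const, Finset.card_univ, Fintype.card_fin, nsmul_eq_mul, ← Finset.sum_mul,
        ← Finset.mul_sum]
      push_cast
      linear_combination h2 + 2 * t * h1 + t ^ 2 * h3

end Distance

/-! ### Cyclicity and the assembly of the theorem -/

/-- A cyclic shift multiplies every evaluation point by `β`, which scales the checks by `β` and
`β²`; the wrap-around agrees because `β^n = 1`. -/
theorem isCyclicCode_of_isSquareCheckCode {K L : Type*} [Field K] [Field L] [Algebra K L] {n : ℕ}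
    {β : Lˣ} (hβ : β ^ n = 1) {e : Fin n ≃ Lˣ} (he : ∀ i, e i = β ^ (i : ℕ)) {ε : ℕ}
    {𝒞 : Submodule K (Fin n → K)} (h : IsSquareCheckCode e ε 𝒞) : IsCyclicCode 𝒞 := by
  intro c hc
  obtain ⟨h0, h1, h2⟩ := (h c).1 hc
  have hrot : ∀ i : Fin n, e (finRotate n i) = β * e i := by
    intro i
    obtain _ | n := n
    · exact i.elim0
    rw [he, he, ← pow_succ']
    obtain hi | hi := (Fin.le_last i).eq_or_lt
    · subst hi
      rw [finRotate_last, Fin.val_last, hβ, Fin.val_zero, pow_zero]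
    · rw [coe_finRotate_of_ne_last hi.ne]
  refine (h _).2 ⟨fun hε => ?_, ?_, ?_⟩
  · rw [← h0 hε]
    exact Equiv.sum_comp (finRotate n).symm c
  · rw [← Equiv.sum_comp (finRotate n)]
    simp only [Equiv.symm_apply_apply, hrot, Units.val_mul, ← mul_smul_comm]
    rw [← Finset.mul_sum, h1, mul_zero]
  · rw [← Equiv.sum_comp (finRotate n)]
    simp only [Equiv.symm_apply_apply, hrot, Units.val_mul, mul_pow, ← mul_smul_comm]
    rw [← Finset.mul_sum, h2, mul_zero]

theorem exists_equiv_pow_inv {L : Type*} [Field L] [Finite L] {α : Lˣ}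
    (hα : ∀ x : Lˣ, x ∈ Subgroup.zpowers α) :
    ∃ e : Fin (Nat.card L - 1) ≃ Lˣ, ∀ i, e i = α⁻¹ ^ (i : ℕ) := by
  have hinj : Function.Injective fun i : Fin (Nat.card L - 1) => α⁻¹ ^ (i : ℕ) := by
    intro i j hij
    have h : α ^ (i : ℕ) = α ^ (j : ℕ) := by simpa using hij
    refine Fin.ext (pow_injOn_Iio_orderOf (x := α) ?_ ?_ h) <;>
    · rw [Set.mem_Iio, orderOf_generator hα]
      exact Fin.is_lt _
  exact ⟨Equiv.ofBijective _ (hinj.bijective_of_nat_card_le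
    (by rw [Nat.card_units, Nat.card_fin])), fun i => rfl⟩

theorem exists_injective_ne_zero {K : Type*} [Field K] [Finite K] {k : ℕ} (h : k < Nat.card K) :
    ∃ s : Fin k → K, Function.Injective s ∧ ∀ j, s j ≠ 0 := by
  have := Fintype.ofFinite Kˣ
  have : Fintype.card (Fin k) ≤ Fintype.card Kˣ := by
    rw [Fintype.card_fin, ← Nat.card_eq_fintype_card, Nat.card_units]; omega
  obtain ⟨f⟩ := Function.Embedding.nonempty_of_card_le this
  exact ⟨fun j => f j, Units.val_injective.comp f.injective, fun j => (f j).ne_zero⟩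

theorem mainTheorem7 {K L : Type*} [Field K] [Finite K] [Field L] [Finite L] [Algebra K L]
    (p e q m n : ℕ) (hp : p.Prime) (he : 0 < e) (hq : q = p ^ e) (hodd : Odd q)
    (hm : 0 < m) (hqm : ¬ (q = 3 ∧ m = 1)) (hn : n = q ^ m - 1)
    (hK : Nat.card K = q) (hL : Nat.card L = q ^ m)
    (α : Lˣ) (hα : ∀ x : Lˣ, x ∈ Subgroup.zpowers α)
    (𝒞 : Submodule K (Fin n → K))
    (h𝒞 : 𝒞 = seqCode (definingSeq K (fun x : L => x ^ 2) (α : L)) n) :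
    IsCyclicCode 𝒞 ∧
    2 * m + NN p m ≤ n ∧
    Module.finrank K 𝒞 = n - 2 * m - NN p m ∧
    IsGeneratorPoly 𝒞 ((Polynomial.X - 1) ^ NN p m *
      minpoly K ((α ^ (-1 : ℤ) : Lˣ) : L) * minpoly K ((α ^ (-2 : ℤ) : Lˣ) : L)) ∧
    (q = 3 → NN p m = 0 → minDist 𝒞 = 4) ∧
    (q = 3 → NN p m = 1 → 4 ≤ minDist 𝒞 ∧ minDist 𝒞 ≤ 5) ∧
    (3 < q → NN p m = 1 → 3 ≤ minDist 𝒞 ∧ minDist 𝒞 ≤ 4) ∧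
    (3 < q → NN p m = 0 → minDist 𝒞 = 3) := by
  classical
  subst hK
  have hq3 : 3 ≤ Nat.card K := by
    have h1 : 1 < Nat.card K := Finite.one_lt_card
    obtain ⟨k, hk⟩ := hodd; omega
  -- For `q = 3` the excluded case forces `m ≥ 2`, so `|L| ≥ 9`; otherwise `|L| ≥ q > 3`.
  have hLcard : 3 < Nat.card L ∧ (Nat.card K = 3 → 5 < Nat.card L) := by
    rw [hL]
    obtain h | h := hq3.eq_or_lt
    · have hm2 : 2 ≤ m := by
        by_contra h2; exact hqm ⟨h.symm, by omega⟩
      have := Nat.pow_le_pow_right (n := Nat.card K) (by omega) hm2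
      have h9 : Nat.card K ^ 2 = 9 := by rw [← h]; rfl
      omega
    · have := Nat.pow_le_pow_right (n := Nat.card K) (by omega) hm
      rw [pow_one] at this
      omega
  obtain ⟨hL3, hL5⟩ := hLcard
  have hfr : Module.finrank K L = m := by
    have := Module.natCard_eq_pow_finrank (K := K) (V := L)
    rw [hL] at this
    exact (Nat.pow_right_injective (by omega) this).symm
  obtain rfl : n = Nat.card L - 1 := by rw [hn, hL]
  have hε : NN p m ≤ 1 := by unfold NN; split_ifs <;> simp
  have hε' : NN p m = 1 ↔ (Module.finrank K L : L) ≠ 0 := by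
    have : CharP L p := by
      have := Fact.mk hp
      have := Fintype.ofFinite K
      have hKp : CharP K p := charP_of_card_eq_prime_pow (f := e)
        (by rw [← Nat.card_eq_fintype_card, hq])
      exact charP_of_injective_algebraMap (algebraMap K L).injective p
    rw [hfr, Ne, CharP.cast_eq_zero_iff L p]
    unfold NN; split_ifs <;> simp_all
  have hgen : (Polynomial.X - 1) ^ NN p m * minpoly K ((α ^ (-1 : ℤ) : Lˣ) : L) *
      minpoly K ((α ^ (-2 : ℤ) : Lˣ) : L) = squareSeqGenPoly K α (NN p m) := by
    rw [squareSeqGenPoly, zpow_neg_one, zpow_neg]; rfl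
  have hmon : (squareSeqGenPoly K α (NN p m)).Monic := squareSeqGenPoly_monic _
  have hdvd := squareSeqGenPoly_dvd (K := K) hα hodd hL3 hε
  have hcode : 𝒞 = codeOfPoly (Nat.card L - 1) (squareSeqGenPoly K α (NN p m)) := by
    rw [h𝒞, seqCode, seqGenPoly_eq hα hodd hL3 hε hε']
  obtain ⟨hdeg, hdim⟩ := finrank_codeOfPoly (by omega) hmon hdvd
  rw [squareSeqGenPoly_natDegree hα hodd, hfr] at hdeg hdim
  obtain ⟨ev, hev⟩ := exists_equiv_pow_inv hα
  have hchk : IsSquareCheckCode ev (NN p m) 𝒞 := by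
    intro c
    rw [hcode, mem_squareSeqCode hα hodd hL3 hε]
    simp only [hev]
  rw [hgen]
  have hupper : ∀ k, (∃ c ∈ 𝒞, c ≠ 0 ∧ hammingNorm c ≤ k) → minDist 𝒞 ≤ k := by
    rintro k ⟨c, hc, hc0, hk⟩
    exact (minDist_le hc hc0).trans hk
  have htern : Nat.card K = 3 → 4 ≤ minDist 𝒞 ∧ minDist 𝒞 ≤ 4 + NN p m := by
    intro h3
    have hex := hchk.exists_word_ternary h3 (hL5 h3) hε
    refine ⟨le_minDist ?_ fun c hc hc0 => hchk.four_le_hammingNorm h3 hc hc0, hupper _ hex⟩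
    obtain ⟨c, hc, hc0, -⟩ := hex
    exact ⟨c, hc, hc0⟩
  have hbig : 3 < Nat.card K → 3 ≤ minDist 𝒞 ∧ minDist 𝒞 ≤ 3 + NN p m := by
    intro h3
    -- An odd `q > 3` is at least `5`, so `K` has the `3 + NN p m ≤ 4` nonzero points needed.
    have h5 : 3 + NN p m < Nat.card K := by
      obtain ⟨k, hk⟩ := hodd; omega
    obtain ⟨s, hs, hs0⟩ := exists_injective_ne_zero h5
    have hex := hchk.exists_word_base hs hs0 (by omega) (by omega)
    refine ⟨le_minDist ?_ fun c hc hc0 => hchk.three_le_hammingNorm hc hc0, hupper _ hex⟩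
    obtain ⟨c, hc, hc0, -⟩ := hex
    exact ⟨c, hc, hc0⟩
  refine ⟨isCyclicCode_of_isSquareCheckCode (unit_pow_card_sub_one _) hev hchk, hdeg, ?_,
    ⟨hmon, hdvd, hcode⟩, fun h h' => ?_, fun h h' => ?_, fun h h' => ?_, fun h h' => ?_⟩
  · rw [hcode, hdim]; omega
  · have := htern h; omega
  · have := htern h; omega
  · have := hbig h; omega
  · have := hbig h; omega
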